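/- Let $n\ge 0$ and $d\ge 2$ be integers, and let $G$ be a strongly connected directed multigraph on $n+1$ vertices (self-loops and multiple edges allowed, each self-loop contributing one to the indegree and one to the outdegree of its vertex) in which every vertex has indegree and outdegree equal to $d$. The simple random walk on $G$ moves at each step along an edge chosen uniformly among the $d$ edges leaving its current vertex; let $\tau_y=\inf\{t\ge 0: X_t=y\}$ be its first hitting time of $y$, and let $\mathbb{E}_x$ denote expectation for the walk started at $x$. Then for all vertices $x,y$ of $G$, $$\mathbb{E}_x[\tau_y]\le \frac d2\, n(n+1).$$ Moreover, if $n\ge 1$, there are vertices $x,y$ of $G$ with $\mathbb{E}_x[\tau_y]=\frac d2\,n(n+1)$ if and only if $G$ is isomorphic to $L(d,n)$, the directed multigraph with vertex set $\{0,1,\dots,n\}$ that has one edge from $k$ to $k-1$ for each $k\ne 0$, one edge from $k$ to $k+1$ for each $k\ne n$, $d-1$ self-loops at each of $0$ and $n$, $d-2$ self-loops at every other vertex, and no other edges. -/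

import Mathlib

open MeasureTheory ProbabilityTheory
open scoped ENNReal

/-- A directed multigraph with vertex set `V`, with self-loops and multiple edges allowed:
`mult v w` is the number of directed edges from `v` to `w`, so `mult v v` is the number of
self-loops at `v`. -/
structure DirMultigraph (V : Type*) where
  mult : V → V → ℕ

namespace DirMultigraph

/-- The outdegree of `v`; a self-loop contributes one. -/
def outDeg {V : Type*} [Fintype V] (G : DirMultigraph V) (v : V) : ℕ :=
  ∑ w, G.mult v w

/-- The indegree of `v`; a self-loop contributes one. -/
def inDeg {V : Type*} [Fintype V] (G : DirMultigraph V) (v : V) : ℕ :=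
  ∑ w, G.mult w v

/-- There is a directed path from every vertex to every vertex. -/
def StronglyConnected {V : Type*} (G : DirMultigraph V) : Prop :=
  ∀ x y : V, Relation.ReflTransGen (fun a b => 0 < G.mult a b) x y

/-- Isomorphism of directed multigraphs: a bijection of the vertices that preserves the number
of edges from any vertex to any other (and the number of self-loops at any vertex). -/
def IsIsomorphicTo {V W : Type*} (G : DirMultigraph V) (H : DirMultigraph W) : Prop :=
  ∃ e : V ≃ W, ∀ a b : V, H.mult (e a) (e b) = G.mult a b

/-- The graph `L(d,n)` on `{0, …, n}` (for `2 ≤ d` and `1 ≤ n`): one edge from each `k ≠ 0` to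
`k - 1`, one edge from each `k ≠ n` to `k + 1`, `d - 1` self-loops at `0` and at `n`, and `d - 2`
self-loops at every other vertex. -/
def line (d n : ℕ) : DirMultigraph (Fin (n + 1)) where
  mult i j :=
    if i = j then (if i.val = 0 ∨ i.val = n then d - 1 else d - 2)
    else if i.val = j.val + 1 ∨ j.val = i.val + 1 then 1
    else 0

section Walk

variable {V : Type*} [Fintype V]

/-- The law of one step of the simple random walk from `v`: an edge leaving `v` is chosen uniformly
at random, so `w` is reached with probability `mult v w / outDeg v`. (At a vertex without
outgoing edges the walk stays put, by convention.) -/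
noncomputable def stepPMF (G : DirMultigraph V) (v : V) : PMF V :=
  if h : G.outDeg v = 0 then PMF.pure v
  else PMF.ofFintype (fun w => (G.mult v w : ℝ≥0∞) / (G.outDeg v : ℝ≥0∞)) (by
    have h0 : (G.outDeg v : ℝ≥0∞) ≠ 0 := by exact_mod_cast h
    simp only [div_eq_mul_inv]
    rw [← Finset.sum_mul, ← Nat.cast_sum]
    exact ENNReal.mul_inv_cancel h0 (ENNReal.natCast_ne_top _))

variable [MeasurableSpace V] [DiscreteMeasurableSpace V]

/-- The transition kernel of the simple random walk. -/
noncomputable def stepKernel (G : DirMultigraph V) : Kernel V V where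
  toFun v := (G.stepPMF v).toMeasure
  measurable' := Measurable.of_discrete

instance (G : DirMultigraph V) : IsMarkovKernel G.stepKernel where
  isProbabilityMeasure v := PMF.toMeasure.isProbabilityMeasure (G.stepPMF v)

/-- The transition kernel at time `t`, as a function of the whole history up to time `t`: it
depends on the current position only. -/
noncomputable def historyKernel (G : DirMultigraph V) (t : ℕ) :
    Kernel (Π _ : Finset.Iic t, V) V :=
  G.stepKernel.comap (fun h => h ⟨t, Finset.mem_Iic.2 le_rfl⟩) (measurable_pi_apply _)

instance (G : DirMultigraph V) (t : ℕ) : IsMarkovKernel (G.historyKernel t) := by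
  unfold historyKernel; infer_instance

/-- The law, on the space `ℕ → V` of trajectories, of the simple random walk on `G` started
at `x`. -/
noncomputable def walkLaw (G : DirMultigraph V) (x : V) : Measure (ℕ → V) :=
  Kernel.trajMeasure (X := fun _ => V) (Measure.dirac x) G.historyKernel

/-- The first hitting time `inf {t ≥ 0 : ω t = y}` of `y` by a trajectory `ω` (`∞` if `y` is never
hit). -/
noncomputable def hitTime {V : Type*} (y : V) (ω : ℕ → V) : ℕ∞ :=
  hittingAfter (fun (t : ℕ) (ω : ℕ → V) => ω t) {y} 0 ω

/-- The expected hitting time of `y` by the simple random walk on `G` started at `x`. -/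
noncomputable def expHitTime (G : DirMultigraph V) (x y : V) : ℝ≥0∞ :=
  ∫⁻ ω, (hitTime y ω : ℝ≥0∞) ∂(G.walkLaw x)

end Walk

end DirMultigraph

/-! Fix the target `y` and let f(v) be the expected hitting time from v. The first-step equation
says that `drift` of f equals d at every v ≠ y. Sort the vertices by f and sum the drift over the
set S of the n - k vertices above position k. Indegrees equal outdegrees, so edges inside S cancel
(`sum_drift`). The c edges entering S and the c edges leaving it, with c ≥ 1 by strong connectivity,
contribute c times the gap between positions k and k + 1, plus nonnegative excesses
(`sum_drift_eq_excess_add`). Hence the gap is at most d(n - k) (`gap_le`), and these bounds add up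
to dn(n+1)/2. Equality forces every gap to be extremal, hence c = 1 and no excess at every cut
(`cut_rigid`): one edge each way between neighbours, nothing longer, and loops fixed by the degree
(`mult_eq_line`). In `line d n` the same cut identity evaluates every gap exactly (`line_gap`). The
gap bound only needs drift at most d, so it also applies to E[min(τ, T)], which is finite for free;
letting T grow proves that the hitting times are finite. -/

namespace DirMultigraph

/-! ### Hitting times as sums of tail probabilities; first-step equation -/

section HittingTime

variable {V : Type*}

/-- The indicator function of the complement of `y`. -/
noncomputable def away (y : V) : V → ℝ≥0∞ := Set.indicator {y}ᶜ 1

lemma away_self (y : V) : away y y = 0 := by simp [away]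

lemma away_of_ne {y v : V} (h : v ≠ y) : away y v = 1 := by simp [away, h]

lemma prod_away_eq (y : V) (ω : ℕ → V) (t : ℕ) :
    ∏ s ∈ Finset.range (t + 1), away y (ω s) = if (t : ℕ∞) < hitTime y ω then 1 else 0 := by
  split_ifs with h
  · refine Finset.prod_eq_one fun s hs => away_of_ne fun hsy => ?_
    have hle : hitTime y ω ≤ (s : ℕ∞) :=
      hittingAfter_le_of_mem (u := fun (t : ℕ) (ω : ℕ → V) => ω t) (s := {y}) (zero_le)
        (by simpa using hsy)
    have : (s : ℕ∞) ≤ t := by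
      exact_mod_cast Nat.lt_succ_iff.1 (Finset.mem_range.1 hs)
    exact absurd h (not_lt.2 (hle.trans this))
  · obtain ⟨j, hj, hjy⟩ := (hittingAfter_le_iff (u := fun (t : ℕ) (ω : ℕ → V) => ω t)
      (s := {y}) (n := 0)).1 (not_lt.1 h)
    refine Finset.prod_eq_zero (i := j) (Finset.mem_range.2 (Nat.lt_succ_iff.2 hj.2)) ?_
    rw [show ω j = y by simpa using hjy, away_self]

lemma hitTime_eq_tsum (y : V) (ω : ℕ → V) :
    (hitTime y ω : ℝ≥0∞) = ∑' t : ℕ, ∏ s ∈ Finset.range (t + 1), away y (ω s) := by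
  simp_rw [prod_away_eq]
  induction hitTime y ω using ENat.recTopCoe with
  | top => simp
  | coe k =>
    rw [tsum_eq_sum (s := Finset.range k)]
    · rw [Finset.sum_congr rfl (g := fun _ => 1)]
      · simp
      · intro t ht
        simp [Finset.mem_range.1 ht]
    · intro t ht
      simp only [Finset.mem_range] at ht
      simp [ht]

variable [Fintype V]

/-- The transition operator of the random walk, killed at the vertex `y`. -/
noncomputable def killedStep (G : DirMultigraph V) (y : V) (g : V → ℝ≥0∞) (v : V) : ℝ≥0∞ :=
  away y v * ∑ w, G.stepPMF v w * g w

/-- The t-th summand is the probability of τ > t, so the sum over t < T is E[min(τ, T)]; this is its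
first-step recursion. -/
lemma sum_range_succ_killedStep (G : DirMultigraph V) (y : V) (T : ℕ) (v : V) :
    ∑ t ∈ Finset.range (T + 1), (G.killedStep y)^[t] (away y) v =
      away y v * (1 + ∑ w, G.stepPMF v w *
        ∑ t ∈ Finset.range T, (G.killedStep y)^[t] (away y) w) := by
  rw [Finset.sum_range_succ', mul_add, add_comm]
  congr 1
  · simp
  · simp_rw [Function.iterate_succ_apply', killedStep, ← Finset.mul_sum]
    rw [Finset.sum_comm]
    simp_rw [Finset.mul_sum]

variable [MeasurableSpace V] [DiscreteMeasurableSpace V]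

instance (G : DirMultigraph V) (x : V) : IsProbabilityMeasure (G.walkLaw x) := by
  unfold walkLaw; infer_instance

lemma lintegral_stepKernel (G : DirMultigraph V) (v : V) (g : V → ℝ≥0∞) :
    ∫⁻ w, g w ∂(G.stepKernel v) = ∑ w, G.stepPMF v w * g w := by
  rw [lintegral_fintype]
  refine Finset.sum_congr rfl fun w _ => ?_
  rw [mul_comm]
  congr 1
  exact PMF.toMeasure_apply_singleton _ _ (MeasurableSet.singleton w)

lemma lintegral_walkLaw_zero (G : DirMultigraph V) (x : V) (g : V → ℝ≥0∞) :
    ∫⁻ ω, g (ω 0) ∂(G.walkLaw x) = g x := by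
  have hmap : (G.walkLaw x).map (Preorder.frestrictLe 0) =
      (Measure.dirac x).map (MeasurableEquiv.piUnique (fun _ : Finset.Iic 0 => V)).symm := by
    rw [walkLaw, Kernel.trajMeasure, Measure.map_comp _ _ (by fun_prop),
      Kernel.traj_map_frestrictLe, Kernel.partialTraj_self, Measure.id_comp]
  have h := congrArg (fun μ => ∫⁻ h, g (h ⟨0, Finset.mem_Iic.2 le_rfl⟩) ∂μ) hmap
  have hm : Measurable fun h : (Π _ : Finset.Iic 0, V) => g (h ⟨0, Finset.mem_Iic.2 le_rfl⟩) :=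
    (Measurable.of_discrete (f := g)).comp (measurable_pi_apply _)
  rw [lintegral_map hm (by fun_prop), lintegral_map hm (by fun_prop), lintegral_dirac] at h
  exact h

/-- The Markov property: conditionally on the history up to t, the next position depends on `ω t`
only. -/
lemma lintegral_walkLaw_succ (G : DirMultigraph V) (x : V) (t : ℕ)
    (F : (Π _ : Finset.Iic t, V) → ℝ≥0∞) (hF : Measurable F) (g : V → ℝ≥0∞) :
    ∫⁻ ω, F (Preorder.frestrictLe t ω) * g (ω (t + 1)) ∂(G.walkLaw x) =
      ∫⁻ ω, F (Preorder.frestrictLe t ω) * ∑ w, G.stepPMF (ω t) w * g w ∂(G.walkLaw x) := by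
  have hg : Measurable g := Measurable.of_discrete
  have h := congrArg (fun μ => ∫⁻ p, F p.1 * g p.2 ∂μ)
    (Kernel.map_frestrictLe_trajMeasure_compProd_eq_map_trajMeasure
      (X := fun _ => V) (μ₀ := Measure.dirac x) (κ := G.historyKernel) (a := t))
  have hm : Measurable fun p : (Π _ : Finset.Iic t, V) × V => F p.1 * g p.2 :=
    (hF.comp measurable_fst).mul (hg.comp measurable_snd)
  have hmp : Measurable fun ω : ℕ → V => (Preorder.frestrictLe t ω, ω (t + 1)) :=
    (Preorder.measurable_frestrictLe t).prodMk (measurable_pi_apply _)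
  rw [Measure.lintegral_compProd hm, lintegral_map hm.lintegral_kernel_prod_right'
    (by fun_prop), lintegral_map hm hmp] at h
  refine h.symm.trans (lintegral_congr fun ω => ?_)
  simp only
  rw [lintegral_const_mul _ hg]
  congr 1
  exact G.lintegral_stepKernel (ω t) g

lemma lintegral_prod_away_mul (G : DirMultigraph V) (x y : V) (t : ℕ) (g : V → ℝ≥0∞) :
    ∫⁻ ω, (∏ s ∈ Finset.range t, away y (ω s)) * g (ω t) ∂(G.walkLaw x) =
      (G.killedStep y)^[t] g x := by
  induction t generalizing g with
  | zero => simpa using G.lintegral_walkLaw_zero x g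
  | succ t ih =>
    have hF : Measurable fun h : (Π _ : Finset.Iic t, V) => ∏ s, away y (h s) :=
      Finset.measurable_prod _ fun s _ =>
        (Measurable.of_discrete (f := away y)).comp (measurable_pi_apply s)
    have hprod (ω : ℕ → V) : ∏ s ∈ Finset.range (t + 1), away y (ω s) =
        ∏ s : Finset.Iic t, away y (Preorder.frestrictLe (π := fun _ => V) t ω s) := by
      rw [show Finset.range (t + 1) = Finset.Iic t by ext; simp]
      exact (Finset.prod_coe_sort (Finset.Iic t) fun s => away y (ω s)).symm
    simp_rw [hprod]
    -- The last step is averaged out, which replaces `g` by `killedStep y g`; hence the induction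
    -- over all `g`.
    rw [G.lintegral_walkLaw_succ x t _ hF g, Function.iterate_succ_apply, ← ih]
    refine lintegral_congr fun ω => ?_
    rw [← hprod, Finset.prod_range_succ, mul_assoc]
    rfl

lemma expHitTime_eq_tsum (G : DirMultigraph V) (x y : V) :
    G.expHitTime x y = ∑' t : ℕ, (G.killedStep y)^[t] (away y) x := by
  have hm (t : ℕ) : Measurable fun ω : ℕ → V => away y (ω t) :=
    (Measurable.of_discrete (f := away y)).comp (measurable_pi_apply t)
  simp_rw [expHitTime, hitTime_eq_tsum]
  rw [lintegral_tsum fun t => (Finset.measurable_prod _ fun s _ => hm s).aemeasurable]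
  refine tsum_congr fun t => ?_
  simp_rw [Finset.prod_range_succ]
  exact G.lintegral_prod_away_mul x y t (away y)

lemma expHitTime_self (G : DirMultigraph V) (y : V) : G.expHitTime y y = 0 := by
  rw [expHitTime_eq_tsum, ENNReal.tsum_eq_zero]
  rintro (_ | t)
  · simp [away_self]
  · simp [Function.iterate_succ_apply', killedStep, away_self]

lemma expHitTime_of_ne (G : DirMultigraph V) {x y : V} (h : x ≠ y) :
    G.expHitTime x y = 1 + ∑ w, G.stepPMF x w * G.expHitTime w y := by
  rw [expHitTime_eq_tsum, tsum_eq_zero_add' ENNReal.summable]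
  congr 1
  · simp [away_of_ne h]
  · simp_rw [Function.iterate_succ_apply', killedStep, away_of_ne h, one_mul, expHitTime_eq_tsum,
      ← ENNReal.tsum_mul_left]
    exact Summable.tsum_finsetSum fun _ _ => ENNReal.summable

end HittingTime

/-! ### Total drift over a vertex set and the edges across its boundary -/

section Cuts

variable {V : Type*} [Fintype V]

/-- `outDeg v` times the expected decrease of `f` in one step of the walk from `v`. -/
noncomputable def drift (G : DirMultigraph V) (f : V → ℝ) (v : V) : ℝ :=
  ∑ w, (G.mult v w : ℝ) * (f v - f w)

lemma drift_eq (G : DirMultigraph V) (hbal : ∀ v, G.inDeg v = G.outDeg v) (f : V → ℝ) (v : V) :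
    G.drift f v = ∑ w, ((G.mult w v : ℝ) * f v - G.mult v w * f w) := by
  have h : ∑ w, (G.mult w v : ℝ) = ∑ w, (G.mult v w : ℝ) := by
    exact_mod_cast hbal v
  simp_rw [drift, mul_sub, Finset.sum_sub_distrib, ← Finset.sum_mul, h]

variable [DecidableEq V]

/-- Inside `S` the contributions to the total drift cancel, so that only the edges crossing the
boundary of `S` count. -/
lemma sum_drift (G : DirMultigraph V) (hbal : ∀ v, G.inDeg v = G.outDeg v) (f : V → ℝ)
    (S : Finset V) :
    ∑ v ∈ S, G.drift f v =
      ∑ v ∈ S, ∑ w ∈ Sᶜ, ((G.mult w v : ℝ) * f v - G.mult v w * f w) := by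
  have h0 : ∑ v ∈ S, ∑ w ∈ S, ((G.mult w v : ℝ) * f v - G.mult v w * f w) = 0 := by
    simp_rw [Finset.sum_sub_distrib]
    rw [sub_eq_zero, Finset.sum_comm]
  simp_rw [G.drift_eq hbal f, ← Finset.sum_add_sum_compl S, Finset.sum_add_distrib, h0, zero_add]

/-- The number of edges that leave `S`, as a real number. -/
noncomputable def cutSize (G : DirMultigraph V) (S : Finset V) : ℝ :=
  ∑ v ∈ S, ∑ w ∈ Sᶜ, (G.mult v w : ℝ)

lemma cutSize_eq_sum_in (G : DirMultigraph V) (hbal : ∀ v, G.inDeg v = G.outDeg v)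
    (S : Finset V) : G.cutSize S = ∑ v ∈ S, ∑ w ∈ Sᶜ, (G.mult w v : ℝ) := by
  have h := G.sum_drift hbal (fun _ => 1) S
  simp only [drift, sub_self, mul_zero, Finset.sum_const_zero, mul_one,
    Finset.sum_sub_distrib] at h
  rw [cutSize]
  linarith

/-- As many edges enter `S` as leave it, so shifting the inner values by `a` and the outer ones by
`b` costs `cutSize` times `a - b`. With `a` the minimum of `f` on `S` and `b` its maximum outside,
all remaining terms are nonnegative. -/
lemma sum_drift_eq_excess_add (G : DirMultigraph V) (hbal : ∀ v, G.inDeg v = G.outDeg v)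
    (f : V → ℝ) (S : Finset V) (a b : ℝ) :
    ∑ v ∈ S, G.drift f v =
      ∑ v ∈ S, ∑ w ∈ Sᶜ, ((G.mult w v : ℝ) * (f v - a) + G.mult v w * (b - f w)) +
        G.cutSize S * (a - b) := by
  have h : G.cutSize S * (a - b) =
      (∑ v ∈ S, ∑ w ∈ Sᶜ, (G.mult w v : ℝ)) * a - (∑ v ∈ S, ∑ w ∈ Sᶜ, (G.mult v w : ℝ)) * b := by
    rw [mul_sub, ← G.cutSize_eq_sum_in hbal, cutSize]
  rw [h, G.sum_drift hbal]
  simp_rw [Finset.sum_mul, ← Finset.sum_sub_distrib, ← Finset.sum_add_distrib]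
  refine Finset.sum_congr rfl fun v _ => Finset.sum_congr rfl fun w _ => ?_
  ring

lemma StronglyConnected.one_le_cutSize {G : DirMultigraph V} (hconn : G.StronglyConnected)
    {S : Finset V} {x z : V} (hx : x ∈ S) (hz : z ∉ S) : 1 ≤ G.cutSize S := by
  obtain ⟨v, hv, w, hw, hvw⟩ : ∃ v ∈ S, ∃ w ∉ S, 0 < G.mult v w := by
    by_contra! hno
    refine hz ?_
    induction hconn x z with
    | refl => exact hx
    | tail _ hbc ih =>
      by_contra hc
      exact absurd hbc (not_lt.2 (hno _ (by_contra fun hb => by exact absurd (ih hb) hb) _ hc))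
  calc (1 : ℝ) ≤ G.mult v w := by exact_mod_cast hvw
    _ ≤ ∑ w ∈ Sᶜ, (G.mult v w : ℝ) :=
      Finset.single_le_sum (f := fun w => (G.mult v w : ℝ)) (fun _ _ => Nat.cast_nonneg _)
        (Finset.mem_compl.2 hw)
    _ ≤ G.cutSize S :=
      Finset.single_le_sum (f := fun v => ∑ w ∈ Sᶜ, (G.mult v w : ℝ))
        (fun _ _ => Finset.sum_nonneg fun _ _ => Nat.cast_nonneg _) hv

end Cuts

/-! ### Sorted vertices: gap bound, rigidity, and the line -/

section Fin

variable {n d : ℕ}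

lemma card_Ioi_castSucc (k : Fin n) : ((Finset.Ioi k.castSucc).card : ℝ) = n - k := by
  rw [Fin.card_Ioi, Fin.val_castSucc, ← Nat.cast_sub k.2.le]
  congr 1

lemma excess_nonneg (G : DirMultigraph (Fin (n + 1))) {f : Fin (n + 1) → ℝ} (hf : Monotone f)
    (k : Fin n) {v w : Fin (n + 1)} (hv : v ∈ Finset.Ioi k.castSucc)
    (hw : w ∈ (Finset.Ioi k.castSucc)ᶜ) :
    0 ≤ (G.mult w v : ℝ) * (f v - f k.succ) ∧ 0 ≤ (G.mult v w : ℝ) * (f k.castSucc - f w) := by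
  simp only [Finset.mem_compl, Finset.mem_Ioi, not_lt] at hv hw
  exact ⟨mul_nonneg (Nat.cast_nonneg _) (sub_nonneg.2 (hf (Fin.castSucc_lt_iff_succ_le.1 hv))),
    mul_nonneg (Nat.cast_nonneg _) (sub_nonneg.2 (hf hw))⟩

lemma gap_le (G : DirMultigraph (Fin (n + 1))) (hconn : G.StronglyConnected)
    (hbal : ∀ v, G.inDeg v = G.outDeg v) {f : Fin (n + 1) → ℝ} (hf : Monotone f)
    (hd : ∀ v, f 0 < f v → G.drift f v ≤ d) (k : Fin n) :
    f k.succ - f k.castSucc ≤ d * (n - k) := by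
  have hk : (k : ℝ) ≤ n := by exact_mod_cast k.2.le
  -- A positive gap puts every vertex above the cut strictly over `f 0`, which is where the drift
  -- bound is available.
  rcases le_or_gt (f k.succ) (f k.castSucc) with hle | hlt
  · have : (0 : ℝ) ≤ d * (n - k) := mul_nonneg (Nat.cast_nonneg _) (sub_nonneg.2 hk)
    linarith
  · have hup : ∑ v ∈ Finset.Ioi k.castSucc, G.drift f v ≤ d * (n - k) := by
      rw [← card_Ioi_castSucc, mul_comm, ← nsmul_eq_mul]
      refine Finset.sum_le_card_nsmul _ _ _ fun v hv => hd v ?_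
      calc f 0 ≤ f k.castSucc := hf (Fin.zero_le _)
        _ < f k.succ := hlt
        _ ≤ f v := hf (Fin.castSucc_lt_iff_succ_le.1 (Finset.mem_Ioi.1 hv))
    have hcut : 1 ≤ G.cutSize (Finset.Ioi k.castSucc) :=
      hconn.one_le_cutSize (x := k.succ) (z := k.castSucc) (by simp)
        (by simp)
    rw [G.sum_drift_eq_excess_add hbal f _ (f k.succ) (f k.castSucc)] at hup
    have h0 := Finset.sum_nonneg fun v (hv : v ∈ Finset.Ioi k.castSucc) =>
      Finset.sum_nonneg fun w (hw : w ∈ (Finset.Ioi k.castSucc)ᶜ) =>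
        add_nonneg (G.excess_nonneg hf k hv hw).1 (G.excess_nonneg hf k hv hw).2
    -- The positive gap is at most `cutSize` times itself, as the cut has size at least 1.
    nlinarith

/-- The expected hitting time of `0` from `k` in `line d n`. -/
noncomputable def lineHit (d n k : ℕ) : ℝ := d * k * (2 * n + 1 - k) / 2

lemma lineHit_zero (d n : ℕ) : lineHit d n 0 = 0 := by simp [lineHit]

lemma lineHit_succ (d n k : ℕ) : lineHit d n (k + 1) = lineHit d n k + d * (n - k) := by
  simp only [lineHit]; push_cast; ring

lemma lineHit_self (d n : ℕ) : lineHit d n n = d / 2 * n * (n + 1) := by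
  simp only [lineHit]; ring

/-- The increments of `lineHit` are exactly the gap bounds. Comparison with index 0 bounds `f`
above; comparison with the last index, in the extremal case, bounds it below. -/
lemma antitone_sub_lineHit {f : Fin (n + 1) → ℝ}
    (hgap : ∀ k : Fin n, f k.succ - f k.castSucc ≤ d * (n - k)) :
    Antitone fun k : Fin (n + 1) => f k - lineHit d n k := by
  rw [Fin.antitone_iff_succ_le]
  intro k
  have := hgap k
  simp only [Fin.val_succ, Fin.val_castSucc, lineHit_succ]
  linarith

lemma le_lineHit {f : Fin (n + 1) → ℝ} (h0 : f 0 ≤ 0)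
    (hgap : ∀ k : Fin n, f k.succ - f k.castSucc ≤ d * (n - k)) (k : Fin (n + 1)) :
    f k ≤ lineHit d n k := by
  have := antitone_sub_lineHit hgap (Fin.zero_le k)
  simp only [Fin.val_zero, lineHit_zero] at this
  linarith

lemma gap_eq {f : Fin (n + 1) → ℝ} (h0 : f 0 ≤ 0)
    (hgap : ∀ k : Fin n, f k.succ - f k.castSucc ≤ d * (n - k))
    (hn : lineHit d n n ≤ f (Fin.last n)) (k : Fin n) :
    f k.succ - f k.castSucc = d * (n - k) := by
  have key (i : Fin (n + 1)) : f i = lineHit d n i := by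
    refine le_antisymm (le_lineHit h0 hgap i) ?_
    have := antitone_sub_lineHit hgap (Fin.le_last i)
    simp only [Fin.val_last] at this
    linarith
  rw [key, key, Fin.val_succ, Fin.val_castSucc, lineHit_succ]
  ring

/-- With an extremal gap, the excess plus (`cutSize` - 1) times the gap is at most 0, and both are
nonnegative, so both vanish. Strict monotonicity of `f` then turns a vanishing excess term into an
equality of vertices. -/
lemma cut_rigid (hd0 : 0 < d) (G : DirMultigraph (Fin (n + 1))) (hconn : G.StronglyConnected)
    (hbal : ∀ v, G.inDeg v = G.outDeg v) {f : Fin (n + 1) → ℝ}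
    (hd : ∀ v, f 0 < f v → G.drift f v ≤ d)
    (hgap : ∀ k : Fin n, f k.succ - f k.castSucc = d * (n - k)) (k : Fin n) :
    G.cutSize (Finset.Ioi k.castSucc) = 1 ∧
      ∀ v w, k.castSucc < v → w ≤ k.castSucc →
        (G.mult w v ≠ 0 → v = k.succ) ∧ (G.mult v w ≠ 0 → w = k.castSucc) := by
  have hpos (k : Fin n) : (0 : ℝ) < d * (n - k) :=
    mul_pos (by exact_mod_cast hd0) (sub_pos.2 (by exact_mod_cast k.2))
  have hf : StrictMono f := Fin.strictMono_iff_lt_succ.2 fun k => by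
    have := hgap k; have := hpos k; linarith
  have hup : ∑ v ∈ Finset.Ioi k.castSucc, G.drift f v ≤ d * (n - k) := by
    rw [← card_Ioi_castSucc, mul_comm, ← nsmul_eq_mul]
    refine Finset.sum_le_card_nsmul _ _ _ fun v hv => hd v (hf ?_)
    exact (Fin.zero_le _).trans_lt (Finset.mem_Ioi.1 hv)
  have hcut : 1 ≤ G.cutSize (Finset.Ioi k.castSucc) :=
    hconn.one_le_cutSize (x := k.succ) (z := k.castSucc) (by simp)
      (by simp)
  rw [G.sum_drift_eq_excess_add hbal f _ (f k.succ) (f k.castSucc), hgap] at hup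
  have hterm : ∀ v ∈ Finset.Ioi k.castSucc, ∀ w ∈ (Finset.Ioi k.castSucc)ᶜ,
      0 ≤ (G.mult w v : ℝ) * (f v - f k.succ) + G.mult v w * (f k.castSucc - f w) :=
    fun v hv w hw =>
      add_nonneg (G.excess_nonneg hf.monotone k hv hw).1 (G.excess_nonneg hf.monotone k hv hw).2
  have hsum := Finset.sum_nonneg fun v hv => Finset.sum_nonneg (hterm v hv)
  have hk := hpos k
  have hsum0 : ∑ v ∈ Finset.Ioi k.castSucc, ∑ w ∈ (Finset.Ioi k.castSucc)ᶜ,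
      ((G.mult w v : ℝ) * (f v - f k.succ) + G.mult v w * (f k.castSucc - f w)) = 0 := by
    nlinarith
  refine ⟨by nlinarith, fun v w hv hw => ?_⟩
  have hv' : v ∈ Finset.Ioi k.castSucc := Finset.mem_Ioi.2 hv
  have hw' : w ∈ (Finset.Ioi k.castSucc)ᶜ := by simpa using hw
  have h1 := (Finset.sum_eq_zero_iff_of_nonneg fun v hv => Finset.sum_nonneg (hterm v hv)).1
    hsum0 v hv'
  have h2 := (Finset.sum_eq_zero_iff_of_nonneg (hterm v hv')).1 h1 w hw'
  obtain ⟨ha, hb⟩ := G.excess_nonneg hf.monotone k hv' hw'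
  refine ⟨fun hm => ?_, fun hm => ?_⟩
  · rcases mul_eq_zero.1 (show (G.mult w v : ℝ) * (f v - f k.succ) = 0 by linarith) with h | h
    · exact absurd (by exact_mod_cast h) hm
    · exact hf.injective (sub_eq_zero.1 h)
  · rcases mul_eq_zero.1 (show (G.mult v w : ℝ) * (f k.castSucc - f w) = 0 by linarith) with h | h
    · exact absurd (by exact_mod_cast h) hm
    · exact (hf.injective (sub_eq_zero.1 h)).symm

lemma line_mult_eq_one (d : ℕ) {v w : Fin (n + 1)}
    (h : v.val = w.val + 1 ∨ w.val = v.val + 1) : (line d n).mult v w = 1 := by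
  have hne : v ≠ w := by rintro rfl; omega
  simp only [line, if_neg hne, if_pos h]

lemma line_mult_eq_zero (d : ℕ) {v w : Fin (n + 1)} (hne : v.val ≠ w.val)
    (h : v.val ≠ w.val + 1) (h' : w.val ≠ v.val + 1) : (line d n).mult v w = 0 := by
  simp only [line, if_neg (Fin.ne_of_val_ne hne), if_neg (not_or.2 ⟨h, h'⟩)]

lemma line_mult_succ_castSucc (d : ℕ) (k : Fin n) :
    (line d n).mult k.succ k.castSucc = 1 :=
  line_mult_eq_one d (Or.inl (by simp))

lemma line_mult_castSucc_succ (d : ℕ) (k : Fin n) :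
    (line d n).mult k.castSucc k.succ = 1 :=
  line_mult_eq_one d (Or.inr (by simp))

/-- For `n = 0` the two ends coincide and the outdegree would be `d - 1`. -/
lemma outDeg_line (hd : 2 ≤ d) (hn : 1 ≤ n) (v : Fin (n + 1)) : (line d n).outDeg v = d := by
  have hterm (w : Fin (n + 1)) : (line d n).mult v w =
      (if v = w then (if v.val = 0 ∨ v.val = n then d - 1 else d - 2) else 0) +
        (if v.val = w.val + 1 then 1 else 0) + (if w.val = v.val + 1 then 1 else 0) := by
    simp only [line, Fin.ext_iff]
    split_ifs <;> omega
  have hpred : ∑ w : Fin (n + 1), (if v.val = w.val + 1 then 1 else 0) =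
      if v.val = 0 then 0 else 1 := by
    induction v using Fin.cases with
    | zero => simp
    | succ i =>
      rw [Finset.sum_eq_single i.castSucc] <;> simp [Fin.ext_iff]
      omega
  have hsucc : ∑ w : Fin (n + 1), (if w.val = v.val + 1 then 1 else 0) =
      if v.val = n then 0 else 1 := by
    induction v using Fin.lastCases with
    | last =>
      simp
      intro w; omega
    | cast i =>
      rw [Finset.sum_eq_single i.succ] <;> simp [Fin.ext_iff]
      omega
  rw [outDeg, Finset.sum_congr rfl fun w _ => hterm w, Finset.sum_add_distrib,
    Finset.sum_add_distrib, hpred, hsucc, Finset.sum_ite_eq]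
  simp only [Finset.mem_univ, if_true]
  split_ifs <;> omega

lemma mult_eq_line (hd2 : 2 ≤ d) (hn : 1 ≤ n) (G : DirMultigraph (Fin (n + 1)))
    (hconn : G.StronglyConnected) (hout : ∀ v, G.outDeg v = d) (hin : ∀ v, G.inDeg v = d)
    {f : Fin (n + 1) → ℝ} (hd : ∀ v, f 0 < f v → G.drift f v ≤ d)
    (hgap : ∀ k : Fin n, f k.succ - f k.castSucc = d * (n - k)) :
    G.mult = (line d n).mult := by
  have hbal : ∀ v, G.inDeg v = G.outDeg v := fun v => (hin v).trans (hout v).symm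
  have hrig := cut_rigid (by omega) G hconn hbal hd hgap
  -- An upward edge from `v` crosses the cut just above `v`; a downward one crosses the cut just
  -- below `v`.
  have hup {v w : Fin (n + 1)} (hvw : v < w) (hm : G.mult v w ≠ 0) : w.val = v.val + 1 := by
    obtain ⟨k, rfl⟩ := Fin.exists_castSucc_eq.2 (Fin.ne_last_of_lt hvw)
    have := ((hrig k).2 w _ hvw le_rfl).1 hm
    simp [this]
  have hdown {v w : Fin (n + 1)} (hvw : w < v) (hm : G.mult v w ≠ 0) : v.val = w.val + 1 := by
    obtain ⟨k, rfl⟩ := Fin.exists_succ_eq.2 (Fin.ne_zero_of_lt hvw)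
    have := ((hrig k).2 _ w Fin.castSucc_lt_succ (Fin.le_castSucc_iff.2 hvw)).2 hm
    simp [this]
  have hcross (k : Fin n) : G.mult k.succ k.castSucc = 1 ∧ G.mult k.castSucc k.succ = 1 := by
    have hk := (hrig k).1
    have h1 := hk
    rw [G.cutSize_eq_sum_in hbal] at h1
    rw [cutSize] at hk
    have hsingle (g : Fin (n + 1) → Fin (n + 1) → ℝ)
        (hg : ∀ v w, k.castSucc < v → w ≤ k.castSucc → ¬ (v = k.succ ∧ w = k.castSucc) →
          g v w = 0) :
        ∑ v ∈ Finset.Ioi k.castSucc, ∑ w ∈ (Finset.Ioi k.castSucc)ᶜ, g v w =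
          g k.succ k.castSucc := by
      rw [Finset.sum_eq_single_of_mem k.succ (by simp),
        Finset.sum_eq_single_of_mem k.castSucc (by simp)]
      · exact fun w hw hne => hg _ _ Fin.castSucc_lt_succ (by simpa using hw) (by tauto)
      · exact fun v hv hne => Finset.sum_eq_zero fun w hw =>
          hg _ _ (by simpa using hv) (by simpa using hw) (by tauto)
    have hval {v w : Fin (n + 1)} (hv : k.castSucc < v) (hw : w ≤ k.castSucc)
        (h : v.val = w.val + 1) : v = k.succ ∧ w = k.castSucc := by
      simp only [Fin.lt_def, Fin.le_def, Fin.ext_iff, Fin.val_castSucc, Fin.val_succ] at *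
      omega
    rw [hsingle fun v w => (G.mult v w : ℝ)] at hk
    · rw [hsingle fun v w => (G.mult w v : ℝ)] at h1
      · exact ⟨by exact_mod_cast hk, by exact_mod_cast h1⟩
      · intro v w hv hw hne
        by_contra hm
        exact hne (hval hv hw (hup (hw.trans_lt hv) (by exact_mod_cast hm)))
    · intro v w hv hw hne
      by_contra hm
      exact hne (hval hv hw (hdown (hw.trans_lt hv) (by exact_mod_cast hm)))
  have hoff {v w : Fin (n + 1)} (hvw : v ≠ w) : G.mult v w = (line d n).mult v w := by
    by_cases hs : v.val = w.val + 1
    · obtain ⟨k, rfl⟩ := Fin.exists_succ_eq.2 (show v ≠ 0 by rintro rfl; simp at hs)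
      obtain rfl : w = k.castSucc := by
        simp only [Fin.ext_iff, Fin.val_castSucc, Fin.val_succ] at *; omega
      rw [(hcross k).1, line_mult_succ_castSucc]
    by_cases hs' : w.val = v.val + 1
    · obtain ⟨k, rfl⟩ := Fin.exists_succ_eq.2 (show w ≠ 0 by rintro rfl; simp at hs')
      obtain rfl : v = k.castSucc := by
        simp only [Fin.ext_iff, Fin.val_castSucc, Fin.val_succ] at *; omega
      rw [(hcross k).2, line_mult_castSucc_succ]
    have h0 : G.mult v w = 0 := by
      by_contra hm
      rcases lt_or_gt_of_ne hvw with h | h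
      · exact hs' (hup h hm)
      · exact hs (hdown h hm)
    rw [h0, line_mult_eq_zero d (Fin.val_ne_of_ne hvw) hs hs']
  funext v w
  rcases eq_or_ne v w with rfl | hvw
  · have h1 := hout v
    have h2 := outDeg_line hd2 hn v
    rw [outDeg, ← Finset.add_sum_erase _ _ (Finset.mem_univ v)] at h1 h2
    rw [Finset.sum_congr rfl fun w hw => hoff (Finset.ne_of_mem_erase hw).symm] at h1
    omega
  · exact hoff hvw

lemma line_gap (hbal : ∀ v, (line d n).inDeg v = (line d n).outDeg v)
    {f : Fin (n + 1) → ℝ} (hd : ∀ v, v ≠ 0 → (line d n).drift f v = d) (k : Fin n) :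
    f k.succ - f k.castSucc = d * (n - k) := by
  have h := (line d n).sum_drift hbal f (Finset.Ioi k.castSucc)
  rw [Finset.sum_congr rfl fun v hv => hd v (Fin.ne_zero_of_lt (Finset.mem_Ioi.1 hv)),
    Finset.sum_const, nsmul_eq_mul, card_Ioi_castSucc,
    Finset.sum_eq_single_of_mem k.succ (by simp),
    Finset.sum_eq_single_of_mem k.castSucc (by simp), line_mult_succ_castSucc,
    line_mult_castSucc_succ] at h
  · push_cast at h; linarith
  · intro w hw hne
    simp only [Finset.mem_compl, Finset.mem_Ioi, not_lt, Fin.le_def, Fin.val_castSucc, ne_eq,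
      Fin.ext_iff] at hw hne
    have h1 : (line d n).mult w k.succ = 0 := by
      apply line_mult_eq_zero <;> simp only [Fin.val_succ] <;> omega
    have h2 : (line d n).mult k.succ w = 0 := by
      apply line_mult_eq_zero <;> simp only [Fin.val_succ] <;> omega
    simp [h1, h2]
  · intro v hv hne
    refine Finset.sum_eq_zero fun w hw => ?_
    simp only [Finset.mem_compl, Finset.mem_Ioi, not_lt, Fin.lt_def,
      Fin.val_castSucc, ne_eq, Fin.ext_iff, Fin.val_succ] at hv hw hne
    have h1 : (line d n).mult w v = 0 := by
      apply line_mult_eq_zero <;> omega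
    have h2 : (line d n).mult v w = 0 := by
      apply line_mult_eq_zero <;> omega
    simp [h1, h2]

end Fin

/-! ### Transport along a renaming of the vertices -/

section Relabel

variable {V W : Type*}

/-- The multigraph on `W` obtained from `G` by renaming the vertices along `e`. -/
def relabel (G : DirMultigraph V) (e : W ≃ V) : DirMultigraph W where
  mult i j := G.mult (e i) (e j)

lemma StronglyConnected.relabel {G : DirMultigraph V} (hconn : G.StronglyConnected)
    (e : W ≃ V) : (G.relabel e).StronglyConnected := fun x y => by
  have h := Relation.ReflTransGen.lift (p := fun a b => 0 < (G.relabel e).mult a b) e.symm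
    (fun a b hab => by simpa [Function.onFun, DirMultigraph.relabel] using hab) _ _ (hconn (e x) (e y))
  simpa [Function.onFun] using h

variable [Fintype V] [Fintype W]

lemma outDeg_relabel (G : DirMultigraph V) (e : W ≃ V) (i : W) :
    (G.relabel e).outDeg i = G.outDeg (e i) :=
  Equiv.sum_comp e fun w => G.mult (e i) w

lemma inDeg_relabel (G : DirMultigraph V) (e : W ≃ V) (i : W) :
    (G.relabel e).inDeg i = G.inDeg (e i) :=
  Equiv.sum_comp e fun w => G.mult w (e i)

lemma drift_relabel (G : DirMultigraph V) (e : W ≃ V) (f : V → ℝ) (i : W) :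
    (G.relabel e).drift (f ∘ e) i = G.drift f (e i) :=
  Equiv.sum_comp e fun w => (G.mult (e i) w : ℝ) * (f (e i) - f w)

end Relabel

/-! ### The bound, its extremal case, and finiteness by truncation -/

section Bound

variable {V : Type*} [Fintype V] {n d : ℕ}

lemma exists_equiv_monotone (hcard : Fintype.card V = n + 1) (f : V → ℝ) :
    ∃ e : Fin (n + 1) ≃ V, Monotone (f ∘ e) := by
  let e₀ : Fin (n + 1) ≃ V := (Fintype.equivFinOfCardEq hcard).symm
  exact ⟨(Tuple.sort (f ∘ e₀)).trans e₀, Tuple.monotone_sort (f ∘ e₀)⟩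

/-- Ties may keep `y` from being `e 0`, but the minimum of `f` is 0 all the same, so a vertex with a
larger value is not `y`. -/
lemma sorted_props {G : DirMultigraph V} (hconn : G.StronglyConnected)
    (hout : ∀ v, G.outDeg v = d) (hin : ∀ v, G.inDeg v = d) {f : V → ℝ} {y : V}
    (hf0 : ∀ v, 0 ≤ f v) (hy : f y = 0) (hd : ∀ v, v ≠ y → G.drift f v ≤ d)
    {e : Fin (n + 1) ≃ V} (he : Monotone (f ∘ e)) :
    (f ∘ e) 0 ≤ 0 ∧ (∀ i, (f ∘ e) 0 < (f ∘ e) i → (G.relabel e).drift (f ∘ e) i ≤ d) ∧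
      ∀ k : Fin n, (f ∘ e) k.succ - (f ∘ e) k.castSucc ≤ d * (n - k) := by
  have hd' (i) (hi : (f ∘ e) 0 < (f ∘ e) i) : (G.relabel e).drift (f ∘ e) i ≤ d := by
    rw [drift_relabel]
    refine hd _ fun hiy => ?_
    have := (hf0 (e 0)).trans_lt hi
    rw [Function.comp_apply, hiy, hy] at this
    exact lt_irrefl _ this
  refine ⟨?_, hd', ?_⟩
  · have := he (Fin.zero_le (e.symm y))
    simpa [hy] using this
  · refine gap_le _ (hconn.relabel e) (fun v => ?_) he hd'
    rw [inDeg_relabel, outDeg_relabel, hin, hout]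

lemma le_of_drift_le (hcard : Fintype.card V = n + 1) {G : DirMultigraph V}
    (hconn : G.StronglyConnected) (hout : ∀ v, G.outDeg v = d) (hin : ∀ v, G.inDeg v = d)
    {f : V → ℝ} {y : V} (hf0 : ∀ v, 0 ≤ f v) (hy : f y = 0)
    (hd : ∀ v, v ≠ y → G.drift f v ≤ d) (v : V) : f v ≤ lineHit d n n := by
  obtain ⟨e, he⟩ := exists_equiv_monotone hcard f
  obtain ⟨h0, -, hgap⟩ := sorted_props hconn hout hin hf0 hy hd he
  have h1 := he (Fin.le_last (e.symm v))
  have h2 := le_lineHit h0 hgap (Fin.last n)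
  simp only [Function.comp_apply, Equiv.apply_symm_apply, Fin.val_last] at h1 h2
  exact h1.trans h2

lemma isIsomorphicTo_line_of_drift_le (hd2 : 2 ≤ d) (hn : 1 ≤ n)
    (hcard : Fintype.card V = n + 1) {G : DirMultigraph V}
    (hconn : G.StronglyConnected) (hout : ∀ v, G.outDeg v = d) (hin : ∀ v, G.inDeg v = d)
    {f : V → ℝ} {x y : V} (hf0 : ∀ v, 0 ≤ f v) (hy : f y = 0)
    (hd : ∀ v, v ≠ y → G.drift f v ≤ d) (hx : lineHit d n n ≤ f x) :
    G.IsIsomorphicTo (line d n) := by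
  obtain ⟨e, he⟩ := exists_equiv_monotone hcard f
  obtain ⟨h0, hd', hgap⟩ := sorted_props hconn hout hin hf0 hy hd he
  have hlast : lineHit d n n ≤ (f ∘ e) (Fin.last n) := by
    have h1 := he (Fin.le_last (e.symm x))
    simp only [Function.comp_apply, Equiv.apply_symm_apply] at h1
    exact hx.trans h1
  have hmult := mult_eq_line hd2 hn (G.relabel e) (hconn.relabel e)
    (fun v => (G.outDeg_relabel e v).trans (hout _))
    (fun v => (G.inDeg_relabel e v).trans (hin _)) hd' (gap_eq h0 hgap hlast)
  refine ⟨e.symm, fun a b => ?_⟩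
  rw [← hmult]
  simp [relabel]

lemma stepPMF_eq_div {G : DirMultigraph V} {v : V} (hd0 : d ≠ 0) (hout : G.outDeg v = d)
    (w : V) : G.stepPMF v w = (G.mult v w : ℝ≥0∞) / d := by
  rw [stepPMF, dif_neg (by rw [hout]; exact hd0), PMF.ofFintype_apply, hout]

lemma drift_toReal {G : DirMultigraph V} (hd0 : d ≠ 0) (hout : ∀ v, G.outDeg v = d)
    {g : V → ℝ≥0∞} (hg : ∀ v, g v ≠ ∞) (v : V) :
    G.drift (fun v => (g v).toReal) v =
      d * ((g v).toReal - (∑ w, G.stepPMF v w * g w).toReal) := by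
  have hd0' : (d : ℝ) ≠ 0 := by exact_mod_cast hd0
  have hsum : ∑ w, (G.mult v w : ℝ) = d := by exact_mod_cast hout v
  rw [ENNReal.toReal_sum fun w _ => ENNReal.mul_ne_top (PMF.apply_ne_top _ _) (hg w), mul_sub,
    Finset.mul_sum, drift]
  simp_rw [mul_sub, Finset.sum_sub_distrib, ← Finset.sum_mul, hsum, ENNReal.toReal_mul,
    stepPMF_eq_div hd0 (hout v), ENNReal.toReal_div, ENNReal.toReal_natCast]
  congr 1
  refine Finset.sum_congr rfl fun w _ => ?_
  field_simp

lemma sum_range_killedStep_ne_top (G : DirMultigraph V) (y : V) (T : ℕ) (v : V) :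
    ∑ t ∈ Finset.range T, (G.killedStep y)^[t] (away y) v ≠ ∞ := by
  have haway (v : V) : away y v ≠ ∞ := by
    rcases eq_or_ne v y with rfl | h
    · simp [away_self]
    · simp [away_of_ne h]
  induction T generalizing v with
  | zero => simp
  | succ T ih =>
    rw [sum_range_succ_killedStep]
    exact ENNReal.mul_ne_top (haway v) (ENNReal.add_ne_top.2 ⟨ENNReal.one_ne_top,
      ENNReal.sum_ne_top.2 fun w _ => ENNReal.mul_ne_top (PMF.apply_ne_top _ _) (ih w)⟩)

lemma ofReal_lineHit_self (d n : ℕ) :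
    ENNReal.ofReal (lineHit d n n) = (d : ℝ≥0∞) / 2 * n * (n + 1) := by
  rw [lineHit_self, ENNReal.ofReal_mul (by positivity), ENNReal.ofReal_mul (by positivity),
    ENNReal.ofReal_div_of_pos two_pos, ENNReal.ofReal_add (by positivity) zero_le_one]
  simp

/-- Away from `y`, u_T ≤ u_{T+1} = 1 + P u_T for the truncated expectations u_T, so their drift is
at most `d`. The resulting bound does not depend on `T`. -/
lemma sum_range_killedStep_le (hd0 : d ≠ 0) (hcard : Fintype.card V = n + 1)
    {G : DirMultigraph V} (hconn : G.StronglyConnected) (hout : ∀ v, G.outDeg v = d)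
    (hin : ∀ v, G.inDeg v = d) (y : V) (T : ℕ) (x : V) :
    ∑ t ∈ Finset.range T, (G.killedStep y)^[t] (away y) x ≤
      ENNReal.ofReal (lineHit d n n) := by
  have hfin := G.sum_range_killedStep_ne_top y
  rw [← ENNReal.ofReal_toReal (hfin T x)]
  refine ENNReal.ofReal_le_ofReal <| le_of_drift_le hcard hconn hout hin (y := y)
    (f := fun x => (∑ t ∈ Finset.range T, (G.killedStep y)^[t] (away y) x).toReal)
    (fun _ => ENNReal.toReal_nonneg) ?_ (fun v hv => ?_) x
  · cases T with
    | zero => simp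
    | succ T => simp [sum_range_succ_killedStep, away_self]
  · rw [drift_toReal hd0 hout (hfin T)]
    have hP : ∑ w, G.stepPMF v w * ∑ t ∈ Finset.range T, (G.killedStep y)^[t] (away y) w ≠ ∞ :=
      ENNReal.sum_ne_top.2 fun w _ => ENNReal.mul_ne_top (PMF.apply_ne_top _ _) (hfin T w)
    have hle : ∑ t ∈ Finset.range T, (G.killedStep y)^[t] (away y) v ≤
        ∑ t ∈ Finset.range (T + 1), (G.killedStep y)^[t] (away y) v :=
      Finset.sum_le_sum_of_subset (Finset.range_subset_range.2 T.le_succ)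
    rw [sum_range_succ_killedStep, away_of_ne hv, one_mul] at hle
    have := ENNReal.toReal_mono (ENNReal.add_ne_top.2 ⟨ENNReal.one_ne_top, hP⟩) hle
    rw [ENNReal.toReal_add ENNReal.one_ne_top hP, ENNReal.toReal_one] at this
    refine mul_le_of_le_one_right (Nat.cast_nonneg _) ?_
    linarith

variable [MeasurableSpace V] [DiscreteMeasurableSpace V]

lemma expHitTime_le (hd0 : d ≠ 0) (hcard : Fintype.card V = n + 1)
    {G : DirMultigraph V} (hconn : G.StronglyConnected) (hout : ∀ v, G.outDeg v = d)
    (hin : ∀ v, G.inDeg v = d) (x y : V) :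
    G.expHitTime x y ≤ ENNReal.ofReal (lineHit d n n) := by
  rw [expHitTime_eq_tsum, ENNReal.tsum_eq_iSup_nat]
  exact iSup_le fun T => sum_range_killedStep_le hd0 hcard hconn hout hin y T x

lemma drift_expHitTime {G : DirMultigraph V} (hd0 : d ≠ 0) (hout : ∀ v, G.outDeg v = d)
    {y : V} (hfin : ∀ v, G.expHitTime v y ≠ ∞) {v : V} (hv : v ≠ y) :
    G.drift (fun v => (G.expHitTime v y).toReal) v = d := by
  have hP : ∑ w, G.stepPMF v w * G.expHitTime w y ≠ ∞ :=
    ENNReal.sum_ne_top.2 fun w _ => ENNReal.mul_ne_top (PMF.apply_ne_top _ _) (hfin w)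
  rw [drift_toReal hd0 hout hfin, expHitTime_of_ne G hv,
    ENNReal.toReal_add ENNReal.one_ne_top hP, ENNReal.toReal_one]
  ring

end Bound

end DirMultigraph

open DirMultigraph in
theorem theorem1p2 {V : Type*} [Fintype V] [MeasurableSpace V] [DiscreteMeasurableSpace V]
    (G : DirMultigraph V) (n d : ℕ) (hd : 2 ≤ d)
    (hcard : Fintype.card V = n + 1)
    (hconn : G.StronglyConnected)
    (hout : ∀ v, G.outDeg v = d) (hin : ∀ v, G.inDeg v = d) :
    (∀ x y : V, G.expHitTime x y ≤ (d : ℝ≥0∞) / 2 * n * (n + 1)) ∧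
    (1 ≤ n →
      ((∃ x y : V, G.expHitTime x y = (d : ℝ≥0∞) / 2 * n * (n + 1)) ↔
        G.IsIsomorphicTo (DirMultigraph.line d n))) := by
  have hd0 : d ≠ 0 := by omega
  have hle := expHitTime_le hd0 hcard hconn hout hin
  have hfin (x y : V) : G.expHitTime x y ≠ ∞ := ne_top_of_le_ne_top ENNReal.ofReal_ne_top (hle x y)
  have hdrift (v y : V) (hv : v ≠ y) := drift_expHitTime hd0 hout (fun v => hfin v y) hv
  have hself (y : V) : (G.expHitTime y y).toReal = 0 := by simp [expHitTime_self]
  rw [← ofReal_lineHit_self]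
  refine ⟨hle, fun hn => ⟨?_, ?_⟩⟩
  · rintro ⟨x, y, hxy⟩
    refine isIsomorphicTo_line_of_drift_le hd hn hcard hconn hout hin
      (f := fun v => (G.expHitTime v y).toReal) (x := x) (y := y)
      (fun _ => ENNReal.toReal_nonneg) (hself y) (fun v hv => (hdrift v y hv).le) ?_
    simp only [hxy]
    rw [ENNReal.toReal_ofReal (by rw [lineHit_self]; positivity)]
  · rintro ⟨e, he⟩
    have hline : G.relabel e.symm = line d n := by
      have h : (G.relabel e.symm).mult = (line d n).mult := by
        funext i j
        simpa [relabel] using (he (e.symm i) (e.symm j)).symm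
      exact congrArg DirMultigraph.mk h
    refine ⟨e.symm (Fin.last n), e.symm 0, ?_⟩
    have hgap := line_gap (d := d) (n := n)
      (f := (fun v => (G.expHitTime v (e.symm 0)).toReal) ∘ e.symm)
      (by rw [← hline]; intro v; rw [inDeg_relabel, outDeg_relabel, hin, hout])
      (by
        rw [← hline]
        intro v hv
        rw [drift_relabel]
        exact hdrift _ _ (e.symm.injective.ne hv))
    -- The exact gaps telescope from the value 0 at the target.
    have hval (k : Fin (n + 1)) :
        (G.expHitTime (e.symm k) (e.symm 0)).toReal = lineHit d n k := by
      induction k using Fin.induction with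
      | zero => simp [hself, lineHit_zero]
      | succ k ih =>
        have := hgap k
        simp only [Function.comp_apply, ih, Fin.val_castSucc] at this
        rw [Fin.val_succ, lineHit_succ]
        linarith
    rw [← ENNReal.ofReal_toReal (hfin _ _), hval, Fin.val_last]
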